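/- For a field $k$, a $k$-vector space $V$ of dimension $n$, and a group representation $\rho : G \to \mathrm{GL}(V)$, a subspace $W \subseteq \wedge^m V$ is called $G$-invariant if $(\wedge^m\rho)(g)W \subseteq W$ for all $g \in G$, and realizable if there are $v_1,\dots,v_m \in V$ with $0 \neq v_1 \wedge \cdots \wedge v_m \in W$. For $0 < m < n$, let the $r$-number $r(\wedge^m(n))$ be the minimum of $\dim W$ over all groups $G$, all fields $k$, all $n$-dimensional irreducible representations $\rho : G \to \mathrm{GL}(V)$ over $k$, and all $G$-invariant realizable subspaces $W \subseteq \wedge^m V$; by convention $r(\wedge^0(n)) = r(\wedge^n(n)) = 1$ for every positive integer $n$. Let $m$ and $n$ be positive integers such that $m$ divides $n$. Then $$ r(\wedge^m(n)) = \left\lfloor \frac{n-1}{m} \right\rfloor + 1 = \frac{n}{m}. $$ -/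

import Mathlib

universe u v w

open scoped exteriorPower

noncomputable section

namespace RNumber

/-- The representation `⋀ᵐρ` on `⋀[k]^m V` induced by a representation `ρ` on `V`. -/
def exteriorRep {k : Type v} {G : Type u} {V : Type w} [Field k] [Group G] [AddCommGroup V]
    [Module k V] (m : ℕ) (ρ : Representation k G V) : Representation k G (⋀[k]^m V) where
  toFun g := exteriorPower.map m (ρ g)
  map_one' := by
    rw [map_one]
    exact exteriorPower.map_id
  map_mul' g h := by
    rw [map_mul]
    exact exteriorPower.map_comp (ρ h) (ρ g)

/-- A subspace `W` is invariant under a representation `σ` of `G`. -/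
def IsInvariant {k : Type v} {G : Type u} {V : Type w} [Field k] [Group G] [AddCommGroup V]
    [Module k V] (σ : Representation k G V) (W : Submodule k V) : Prop :=
  ∀ g : G, ∀ x ∈ W, σ g x ∈ W

/-- A subspace of `⋀[k]^m V` is realizable if it contains a nonzero decomposable vector
`v₁ ∧ ⋯ ∧ vₘ`. -/
def IsRealizable {k : Type v} {V : Type w} [Field k] [AddCommGroup V] [Module k V] {m : ℕ}
    (W : Submodule k (⋀[k]^m V)) : Prop :=
  ∃ x : Fin m → V, exteriorPower.ιMulti k m x ≠ 0 ∧ exteriorPower.ιMulti k m x ∈ W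

/-- The set of dimensions of the `G`-invariant realizable subspaces of `⋀[k]^m V`, for all groups
`G`, all fields `k`, and all `n`-dimensional irreducible representations `V` of `G` over `k`. -/
def dimSet (m n : ℕ) : Set ℕ :=
  {d | ∃ (G : Type u) (_ : Group G) (k : Type v) (_ : Field k)
      (V : Type w) (_ : AddCommGroup V) (_ : Module k V) (_ : FiniteDimensional k V)
      (ρ : Representation k G V) (W : Submodule k (⋀[k]^m V)),
      Module.finrank k V = n ∧ ρ.IsIrreducible ∧ IsInvariant (exteriorRep m ρ) W ∧
        IsRealizable W ∧ Module.finrank k W = d}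

open Classical in
/-- The `r`-number `r(⋀ᵐ(n))`: the minimum of `dimSet m n` for `0 < m < n`, and `1` by convention
for `m = 0` and for `m = n`. (A positive value of `sInf` on `ℕ` is attained, so it is a genuine
minimum of a nonempty set.) -/
def rNumber (m n : ℕ) : ℕ :=
  if m = 0 ∨ m = n then 1 else sInf (dimSet.{u, v, w} m n)

end RNumber

end

open Module

namespace RNumber

/-! ### Lower bound: `n ≤ m * dim W` -/

section LowerBound

variable {k : Type v} {G : Type u} {V : Type w} [Field k] [Group G] [AddCommGroup V] [Module k V]

/-! Lower bound: the factors of a nonzero decomposable vector lie in any subspace `U` such that the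
vector is a combination of wedges from `U` (`mem_of_ιMulti_mem_span`). If `W` contains `x₁ ∧ ⋯ ∧ xₘ
≠ 0`, choose at most `dim W` of its translates spanning its orbit; their factors span some `U` with
`dim U ≤ m * dim W`. All translates of the `xⱼ` lie in `U`, so `U = V` by irreducibility.

Sharpness: split a basis of `V` into `d = n / m` blocks of size `m`. Signed permutations preserving
the blocks act irreducibly when `2 ≠ 0`, and permute the wedges of the blocks up to sign, so these
span an invariant realizable `W` with `dim W ≤ d`. -/

lemma exteriorRep_ιMulti {m : ℕ} (ρ : Representation k G V) (g : G) (x : Fin m → V) :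
    exteriorRep m ρ g (exteriorPower.ιMulti k m x) =
      exteriorPower.ιMulti k m (fun j => ρ g (x j)) :=
  exteriorPower.map_apply_ιMulti _ _

/-- If every vector in a set `S` of `⋀ᵐV` is a wedge of vectors of `U`, then every nonzero
decomposable vector in the span of `S` is a wedge of vectors of `U`. -/
lemma mem_of_ιMulti_mem_span {m : ℕ} {U : Submodule k V} {S : Set (⋀[k]^m V)}
    (hS : ∀ t ∈ S, ∃ y : Fin m → V, (∀ j, y j ∈ U) ∧ exteriorPower.ιMulti k m y = t)
    {x : Fin m → V} (hx : exteriorPower.ιMulti k m x ∈ Submodule.span k S)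
    (hx0 : exteriorPower.ιMulti k m x ≠ 0) (j : Fin m) : x j ∈ U := by
  by_contra hj
  obtain ⟨f, hf, hfU⟩ := Submodule.exists_le_ker_of_notMem hj
  -- A projection that is the identity on `U` and kills `x j`: its exterior power fixes the span of
  -- `S` yet kills the wedge of `x`.
  let φ : V →ₗ[k] V := LinearMap.id - (f.smulRight ((f (x j))⁻¹ • x j))
  have hφU : ∀ y ∈ U, φ y = y := fun y hy => by
    have : f y = 0 := hfU hy
    simp [φ, this]
  have hφx : φ (x j) = 0 := by
    simp [φ, smul_smul, mul_inv_cancel₀ hf]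
  have hfix : ∀ t ∈ Submodule.span k S, exteriorPower.map m φ t = t := by
    intro t ht
    have : Set.EqOn (exteriorPower.map m φ) (LinearMap.id : ⋀[k]^m V →ₗ[k] ⋀[k]^m V) S := by
      intro t ht
      obtain ⟨y, hy, rfl⟩ := hS t ht
      rw [exteriorPower.map_apply_ιMulti, LinearMap.id_apply]
      congr 1
      funext i
      exact hφU _ (hy i)
    exact LinearMap.eqOn_span this ht
  apply hx0
  rw [← hfix _ hx, exteriorPower.map_apply_ιMulti]
  exact (exteriorPower.ιMulti k m).map_coord_zero j hφx

/-- An irreducible representation is spanned by the orbits of a family of vectors that are not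
all zero. -/
lemma span_orbit_eq_top {ι : Type*} (ρ : Representation k G V) (hρ : ρ.IsIrreducible)
    (x : ι → V) (hx : ∃ j, x j ≠ 0) :
    Submodule.span k (Set.range fun p : G × ι => ρ p.1 (x p.2)) = ⊤ := by
  let T : Subrepresentation ρ :=
    { toSubmodule := Submodule.span k (Set.range fun p : G × ι => ρ p.1 (x p.2))
      apply_mem_toSubmodule := by
        intro g v hv
        induction hv using Submodule.span_induction with
        | mem v hv =>
          obtain ⟨p, rfl⟩ := hv
          refine Submodule.subset_span ⟨(g * p.1, p.2), ?_⟩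
          simp
        | zero => simp
        | add a b _ _ ha hb => rw [map_add]; exact Submodule.add_mem _ ha hb
        | smul c a _ ha => rw [map_smul]; exact Submodule.smul_mem _ _ ha }
  rcases hρ.eq_bot_or_eq_top T with h | h
  · obtain ⟨j, hj⟩ := hx
    have h1 : x j ∈ T.toSubmodule := Submodule.subset_span ⟨(1, j), by simp⟩
    rw [h] at h1
    exact absurd ((Submodule.mem_bot k).1 h1) hj
  · exact congrArg Subrepresentation.toSubmodule h

theorem finrank_le_finrank_mul [FiniteDimensional k V] {m : ℕ} (hm : 0 < m)
    (ρ : Representation k G V) (hρ : ρ.IsIrreducible) (W : Submodule k (⋀[k]^m V))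
    (hW : IsInvariant (exteriorRep m ρ) W) (hr : IsRealizable W) :
    finrank k V ≤ finrank k W * m := by
  obtain ⟨x, hx0, hxW⟩ := hr
  set ω := exteriorPower.ιMulti k m x with hω
  -- The basis is taken inside the orbit, so that each of its vectors is decomposable.
  obtain ⟨b, hbS, hbspan, hbli⟩ :=
    exists_linearIndependent k (Set.range fun g : G => exteriorRep m ρ g ω)
  have hbW : Submodule.span k b ≤ W := by
    rw [Submodule.span_le]
    intro t ht
    obtain ⟨g, rfl⟩ := hbS ht
    exact hW g _ hxW
  have : Finite b := hbli.finite
  have : Fintype b := Fintype.ofFinite b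
  have hcard : Fintype.card b ≤ finrank k W := by
    rw [← Set.toFinset_card, ← finrank_span_set_eq_card hbli]
    exact Submodule.finrank_mono hbW
  choose g hg using fun t : b => hbS t.2
  let U := Submodule.span k (Set.range fun p : b × Fin m => ρ (g p.1) (x p.2))
  have hmem : ∀ h j, ρ h (x j) ∈ U := by
    intro h
    refine mem_of_ιMulti_mem_span (S := b) (x := fun j => ρ h (x j)) ?_ ?_ ?_
    · intro t ht
      refine ⟨fun j => ρ (g ⟨t, ht⟩) (x j),
        fun j => Submodule.subset_span ⟨(⟨t, ht⟩, j), rfl⟩, ?_⟩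
      rw [← exteriorRep_ιMulti]
      exact hg ⟨t, ht⟩
    · rw [← exteriorRep_ιMulti, hbspan]
      exact Submodule.subset_span ⟨h, rfl⟩
    · rw [← exteriorRep_ιMulti]
      intro h0
      apply hx0
      have := congrArg (exteriorRep m ρ h⁻¹) h0
      simpa [← Module.End.mul_apply, ← map_mul] using this
  have htop : U = ⊤ := by
    rw [eq_top_iff, ← span_orbit_eq_top ρ hρ x ⟨⟨0, hm⟩, fun h0 => hx0
      ((exteriorPower.ιMulti k m).map_coord_zero _ h0)⟩, Submodule.span_le]
    rintro _ ⟨p, rfl⟩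
    exact hmem _ _
  calc finrank k V = finrank k U := by rw [htop, finrank_top]
    _ ≤ Fintype.card (b × Fin m) := finrank_range_le_card _
    _ = Fintype.card b * m := by simp
    _ ≤ finrank k W * m := Nat.mul_le_mul_right _ hcard

end LowerBound

/-! ### The block-monomial representation -/

section BlockRepresentation

variable {k : Type v} {V : Type w} [Field k] [AddCommGroup V] [Module k V] {d m : ℕ}

/-- Signs on the index set `Fin d × Fin m`, together with a permutation of the blocks and a
permutation inside each block. -/
abbrev BlockGen (d m : ℕ) : Type :=
  (Fin d × Fin m → ℤˣ) × Equiv.Perm (Fin d) × Equiv.Perm (Fin m)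

/-- The signed permutation of a basis given by a generator. -/
noncomputable def signedPerm (b : Basis (Fin d × Fin m) k V) (s : BlockGen d m) : V ≃ₗ[k] V :=
  b.equiv (b.unitsSMul fun i => Units.map (Int.castRingHom k : ℤ →* k) (s.1 i))
    (Equiv.prodCongr s.2.1 s.2.2)

lemma signedPerm_apply (b : Basis (Fin d × Fin m) k V) (s : BlockGen d m) (i : Fin d × Fin m) :
    signedPerm b s (b i) =
      ((s.1 (s.2.1 i.1, s.2.2 i.2) : ℤ) : k) • b (s.2.1 i.1, s.2.2 i.2) := by
  simp [signedPerm, Basis.unitsSMul_apply, Units.smul_def, Prod.map]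

/-- The representation of the free group on the signed permutations preserving the blocks. -/
noncomputable def blockRep (b : Basis (Fin d × Fin m) k V) :
    Representation k (ULift.{u} (FreeGroup (BlockGen d m))) V :=
  ((LinearEquiv.automorphismGroup.toLinearMapMonoidHom).comp
    (FreeGroup.lift (signedPerm b))).comp (MulEquiv.ulift.toMonoidHom)

lemma blockRep_of (b : Basis (Fin d × Fin m) k V) (s : BlockGen d m) (v : V) :
    blockRep.{u} b (ULift.up (FreeGroup.of s)) v = signedPerm b s v := by
  change (FreeGroup.lift (signedPerm b) (FreeGroup.of s)) v = _
  rw [FreeGroup.lift_apply_of]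

/-- The wedge of the basis vectors of a block. -/
noncomputable def blockWedge (b : Basis (Fin d × Fin m) k V) (a : Fin d) : ⋀[k]^m V :=
  exteriorPower.ιMulti k m fun j => b (a, j)

lemma blockWedge_ne_zero (b : Basis (Fin d × Fin m) k V) (a : Fin d) : blockWedge b a ≠ 0 := by
  intro h
  have h1 := congrArg (exteriorPower.pairingDual k V m
    (exteriorPower.ιMulti k m fun j => b.coord (a, j))) h
  -- Pairing with the wedge of the dual coordinates gives the determinant of the identity matrix.
  rw [blockWedge, exteriorPower.pairingDual_ιMulti_ιMulti, map_zero] at h1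
  have h2 : (Matrix.of fun i j : Fin m => b.coord (a, j) (b (a, i))) = 1 := by
    ext i j
    simp [Matrix.one_apply, Finsupp.single_apply]
  rw [h2, Matrix.det_one] at h1
  exact one_ne_zero h1

lemma map_signedPerm_blockWedge (b : Basis (Fin d × Fin m) k V) (s : BlockGen d m) (a : Fin d) :
    exteriorPower.map m (signedPerm b s : V →ₗ[k] V) (blockWedge b a) ∈
      Submodule.span k (Set.range (blockWedge b)) := by
  rw [blockWedge, exteriorPower.map_apply_ιMulti]
  have h1 : (((signedPerm b s : V →ₗ[k] V) : V → V) ∘ fun j => b (a, j)) =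
      fun j => ((s.1 (s.2.1 a, s.2.2 j) : ℤ) : k) • ((fun j => b (s.2.1 a, j)) ∘ s.2.2) j := by
    funext j
    exact signedPerm_apply b s (a, j)
  rw [h1, AlternatingMap.map_smul_univ, AlternatingMap.map_perm]
  refine Submodule.smul_mem _ _ ?_
  rw [Units.smul_def]
  exact Submodule.smul_of_tower_mem _ _ (Submodule.subset_span ⟨s.2.1 a, rfl⟩)

/-- A finite-dimensional subspace invariant under the generators of a free group is invariant. -/
lemma freeGroup_apply_mem {α : Type*} {E : Type*} [AddCommGroup E] [Module k E]
    (σ : Representation k (FreeGroup α) E) (W : Submodule k E) [FiniteDimensional k W]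
    (h : ∀ s, ∀ x ∈ W, σ (FreeGroup.of s) x ∈ W) (g : FreeGroup α) : ∀ x ∈ W, σ g x ∈ W := by
  have hcancel : ∀ (g : FreeGroup α) x, σ g (σ g⁻¹ x) = x := fun g x => by
    simp [← Module.End.mul_apply, ← map_mul]
  induction g using FreeGroup.induction_on with
  | C1 => simp
  | of s => exact h s
  | inv_of s _ =>
    intro x hx
    -- An injective endomorphism of the finite-dimensional `W` is onto, so the inverse generator
    -- preserves `W` too.
    have hinj : Function.Injective ((σ (FreeGroup.of s)).restrict (h s)) := by
      intro y z hyz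
      have h1 := congrArg (σ (FreeGroup.of s)⁻¹) (congrArg Subtype.val hyz)
      have hc := hcancel (FreeGroup.of s)⁻¹
      rw [inv_inv] at hc
      simp only [LinearMap.coe_restrict_apply, hc] at h1
      exact Subtype.ext h1
    obtain ⟨y, hy⟩ := LinearMap.injective_iff_surjective.1 hinj ⟨x, hx⟩
    have h1 := congrArg (σ (FreeGroup.of s)⁻¹) (congrArg Subtype.val hy)
    have hc := hcancel (FreeGroup.of s)⁻¹
    rw [inv_inv] at hc
    simp only [LinearMap.coe_restrict_apply, hc] at h1
    rw [← h1]
    exact y.2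
  | mul a c ha hc =>
    intro x hx
    rw [map_mul]
    exact ha _ (hc _ hx)

lemma isInvariant_span_blockWedge (b : Basis (Fin d × Fin m) k V) :
    IsInvariant (exteriorRep m (blockRep.{u} b))
      (Submodule.span k (Set.range (blockWedge b))) := by
  have : FiniteDimensional k (Submodule.span k (Set.range (blockWedge b))) :=
    FiniteDimensional.span_of_finite k (Set.finite_range _)
  let σ : Representation k (FreeGroup (BlockGen d m)) (⋀[k]^m V) :=
    (exteriorRep m (blockRep.{u} b)).comp MulEquiv.ulift.symm.toMonoidHom
  have hσ : ∀ g, σ g = exteriorRep m (blockRep.{u} b) (ULift.up g) := fun _ => rfl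
  suffices h : ∀ s, ∀ x ∈ Submodule.span k (Set.range (blockWedge b)),
      σ (FreeGroup.of s) x ∈ Submodule.span k (Set.range (blockWedge b)) by
    intro g x hx
    have h1 := freeGroup_apply_mem σ _ h g.down x hx
    rwa [hσ] at h1
  intro s x hx
  have hmap : exteriorRep m (blockRep.{u} b) (ULift.up (FreeGroup.of s)) =
      exteriorPower.map m (signedPerm b s : V →ₗ[k] V) :=
    congrArg (exteriorPower.map m) (LinearMap.ext fun v => blockRep_of.{u} b s v)
  rw [hσ, hmap]
  induction hx using Submodule.span_induction with
  | mem x hx =>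
    obtain ⟨a, rfl⟩ := hx
    exact map_signedPerm_blockWedge b s a
  | zero => simp
  | add y z _ _ hy hz => rw [map_add]; exact Submodule.add_mem _ hy hz
  | smul c y _ hy => rw [map_smul]; exact Submodule.smul_mem _ _ hy

/-- Subtracting from a vector its image under the reflection in the `i`-th coordinate leaves twice
its `i`-th component. -/
lemma sub_signedPerm_reflection (b : Basis (Fin d × Fin m) k V) (i : Fin d × Fin m) (v : V) :
    v - signedPerm b (Function.update 1 i (-1), 1, 1) v = (2 * b.repr v i) • b i := by
  have : LinearMap.id - (signedPerm b (Function.update 1 i (-1), 1, 1) : V →ₗ[k] V) =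
      (2 • b.coord i).smulRight (b i) := by
    refine b.ext fun j => ?_
    have := signedPerm_apply b (Function.update 1 i (-1), 1, 1) j
    by_cases hj : j = i
    · subst hj
      simp_all [two_smul, add_smul]
    · simp_all [Function.update_of_ne]
  simpa [two_mul, two_smul] using LinearMap.congr_fun this v

/-- A reflection extracts from any nonzero invariant subspace a nonzero multiple of some `b i`, as
`2 ≠ 0`; permutations of blocks and within blocks are transitive on the basis. -/
lemma isIrreducible_blockRep (b : Basis (Fin d × Fin m) k V) (h2 : (2 : k) ≠ 0) (hd : 0 < d)
    (hm : 0 < m) : (blockRep.{u} b).IsIrreducible := by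
  have hmem : ∀ (T : Subrepresentation (blockRep.{u} b)) s, ∀ v ∈ T.toSubmodule,
      signedPerm b s v ∈ T.toSubmodule := fun T s v hv => by
    rw [← blockRep_of]
    exact T.apply_mem_toSubmodule _ hv
  have hnt : Nontrivial (Subrepresentation (blockRep.{u} b)) := by
    refine ⟨⊥, ⊤, fun h => ?_⟩
    have h1 : (⊥ : Submodule k V) = ⊤ := congrArg Subrepresentation.toSubmodule h
    have h3 : b (⟨0, hd⟩, ⟨0, hm⟩) ∈ (⊥ : Submodule k V) := h1 ▸ Submodule.mem_top
    exact b.ne_zero _ ((Submodule.mem_bot k).1 h3)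
  refine { eq_bot_or_eq_top := fun T => ?_ }
  by_cases hT : T.toSubmodule = ⊥
  · exact Or.inl (Subrepresentation.toSubmodule_injective hT)
  · refine Or.inr (Subrepresentation.toSubmodule_injective (eq_top_iff.2 ?_))
    obtain ⟨v, hv, hv0⟩ := Submodule.exists_mem_ne_zero_of_ne_bot hT
    obtain ⟨i, hi⟩ : ∃ i, b.repr v i ≠ 0 := by
      by_contra! h
      exact hv0 (b.repr.map_eq_zero_iff.1 (Finsupp.ext h))
    have hbi : b i ∈ T.toSubmodule := by
      have h3 := T.toSubmodule.sub_mem hv (hmem T (Function.update 1 i (-1), 1, 1) v hv)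
      rw [sub_signedPerm_reflection] at h3
      exact (Submodule.smul_mem_iff _ (mul_ne_zero h2 hi)).1 h3
    change (⊤ : Submodule k V) ≤ _
    rw [← b.span_eq, Submodule.span_le]
    rintro _ ⟨j, rfl⟩
    have h3 := hmem T (1, Equiv.swap i.1 j.1, Equiv.swap i.2 j.2) _ hbi
    rw [signedPerm_apply] at h3
    simpa using h3

end BlockRepresentation

/-! ### Computing the `r`-number -/

/-- The inequality suffices: the lower bound forces equality, so independence of the block wedges is
not needed. -/
lemma exists_mem_dimSet_le {d m : ℕ} (hd : 0 < d) (hm : 0 < m) :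
    ∃ e ∈ dimSet.{u, v, w} m (d * m), e ≤ d := by
  let k := ULift.{v} ℚ
  let V := ULift.{w} (Fin d × Fin m → ℚ)
  let b : Basis (Fin d × Fin m) k V := Basis.ofEquivFun
    { toFun := fun f i => ULift.up (f.down i)
      invFun := fun f => ULift.up fun i => (f i).down
      map_add' := fun _ _ => rfl
      map_smul' := fun _ _ => rfl
      left_inv := fun _ => rfl
      right_inv := fun _ => rfl }
  have h2 : (2 : k) ≠ 0 := fun h => two_ne_zero (α := ℚ) (congrArg ULift.down h)
  let W := Submodule.span k (Set.range (blockWedge b))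
  refine ⟨finrank k W, ⟨ULift.{u} (FreeGroup (BlockGen d m)), inferInstance, k, inferInstance, V,
    inferInstance, inferInstance, b.finiteDimensional_of_finite, blockRep b, W, ?_,
    isIrreducible_blockRep b h2 hd hm, isInvariant_span_blockWedge b,
    ⟨_, blockWedge_ne_zero b ⟨0, hd⟩, Submodule.subset_span ⟨⟨0, hd⟩, rfl⟩⟩, rfl⟩, ?_⟩
  · rw [finrank_eq_card_basis b]
    simp
  · exact (finrank_range_le_card _).trans_eq (Fintype.card_fin d)

lemma le_mul_of_mem_dimSet {m n e : ℕ} (hm : 0 < m) (he : e ∈ dimSet.{u, v, w} m n) :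
    n ≤ e * m := by
  obtain ⟨G, _, k, _, V, _, _, _, ρ, W, rfl, hρ, hW, hr, rfl⟩ := he
  exact finrank_le_finrank_mul hm ρ hρ W hW hr

theorem rNumber_mul_self {d m : ℕ} (hd : 0 < d) (hm : 0 < m) :
    rNumber.{u, v, w} m (d * m) = d := by
  rw [rNumber]
  split_ifs with h
  · rcases h with h | h
    · omega
    -- Here `m = d * m`, so `d = 1`, in agreement with the convention.
    · exact (Nat.eq_of_mul_eq_mul_right hm (by omega : d * m = 1 * m)).symm
  · obtain ⟨e, he, hed⟩ := exists_mem_dimSet_le.{u, v, w} hd hm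
    apply le_antisymm
    · exact (Nat.sInf_le he).trans hed
    · exact Nat.le_of_mul_le_mul_right (le_mul_of_mem_dimSet hm (Nat.sInf_mem ⟨e, he⟩)) hm

end RNumber

theorem mainTheorem9 (m n : ℕ) (hm : 0 < m) (hn : 0 < n) (hmn : m ∣ n) :
    (RNumber.rNumber.{u, v, w} m n : ℤ) = ⌊((n : ℚ) - 1) / (m : ℚ)⌋ + 1 ∧
      (RNumber.rNumber.{u, v, w} m n : ℚ) = (n : ℚ) / (m : ℚ) := by
  obtain ⟨d, rfl⟩ := hmn
  have hd : 0 < d := Nat.pos_of_mul_pos_left hn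
  have hm' : (1 : ℚ) ≤ m := by exact_mod_cast hm
  rw [Nat.mul_comm, RNumber.rNumber_mul_self hd hm]
  push_cast
  constructor
  -- `(d * m - 1) / m = d - 1 / m` lies in `[d - 1, d)` because `m ≥ 1`.
  · rw [eq_comm, ← eq_sub_iff_add_eq, Int.floor_eq_iff, le_div_iff₀ (by linarith),
      div_lt_iff₀ (by linarith)]
    push_cast
    constructor <;> nlinarith
  · field_simp
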